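/- Let $\mathcal H$ be a complex Hilbert space with inner product $(\cdot,\cdot)$ linear in the first argument, and let $\Omega\subseteq\mathbb C$ be a domain (non-empty, open and connected). Conventions. A sesquilinear form $\mathbf a$ in $\mathcal H$ with domain the subspace $\operatorname{dom}\mathbf a$ is linear in its first and conjugate-linear in its second argument; $\mathbf a[f]:=\mathbf a[f,f]$, and for a subspace $D\subseteq \operatorname{dom}\mathbf a$ we put $W(\mathbf a|_D):=\{\mathbf a[f]: f\in D,\ \|f\|=1\}$ and $W(\mathbf a):=W(\mathbf a|_{\operatorname{dom}\mathbf a})$. The form $\mathbf a$ is sectorial if $W(\mathbf a)\subseteq\{z:|\arg(z-\gamma)|\le\vartheta\}$ for some $\gamma\in\mathbb R$, $\vartheta\in[0,\frac\pi2)$. We write $f_n\to_{\mathbf a} f$ if $f_n\in\operatorname{dom}\mathbf a$, $f_n\to f$ in $\mathcal H$ and $\mathbf a[f_n-f_m]\to0$ as $n,m\to\infty$; $\mathbf a$ is closed if $f_n\to_{\mathbf a}f$ implies $f\in\operatorname{dom}\mathbf a$ and $\mathbf a[f_n-f]\to0$. A core of a closed sectorial form $\mathbf a$ is a subspace $D\subseteq\operatorname{dom}\mathbf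 a$ such that each $f\in\operatorname{dom}\mathbf a$ satisfies $f_n\to_{\mathbf a}f$ for some sequence $(f_n)$ in $D$. Let $\mathbf t(\lambda)$, $\lambda\in\Omega$, be a holomorphic form family of type (a): every $\mathbf t(\lambda)$ is a densely defined closed sectorial form in $\mathcal H$, the domain $\mathcal D_{\mathbf t}=\operatorname{dom}\mathbf t(\lambda)$ does not depend on $\lambda$, and $\lambda\mapsto\mathbf t(\lambda)[f]$ is holomorphic on $\Omega$ for every $f\in\mathcal D_{\mathbf t}$. For $k\in\mathbb N_0$ let $\mathbf t^{(k)}(\mu)[f]$, $f\in\mathcal D_{\mathbf t}$, be the $k$-th derivative of $\lambda\mapsto\mathbf t(\lambda)[f]$ at $\mu$; for a subspace $D\subseteq\mathcal D_{\mathbf t}$ put $W(\mathbf t^{(k)}(\mu)|_D):=\{\mathbf t^{(k)}(\mu)[f]:f\in D,\ \|f\|=1\}$. Let $T(\lambda)$, $\lambda\in\Omega$, be the associated family of m-sectorial operators, holomorphic of type (B): $f\in\operatorname{dom}T(\lambda)$ and $T(\lambda)f=w$ if and only if $f\in\mathcal D_{\mathbf t}$ and $\mathbf t(\lambda)[f,g]=(w,g)$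 for all $g\in\mathcal D_{\mathbf t}$. For operator functions and form functions on $\Omega$ define $$\sigma(T)=\{\lambda\in\Omega:0\in\sigma(T(\lambda))\},$$ $$W(T)=\{\lambda\in\Omega:\exists f\in\operatorname{dom}T(\lambda),\ f\ne0,\ (T(\lambda)f,f)=0\},\qquad W(\mathbf t)=\{\lambda\in\Omega:\exists f\in\operatorname{dom}\mathbf t(\lambda),\ f\neq0,\ \mathbf t(\lambda)[f]=0\},$$ $$W_\Psi(T)=\bigcap_{\varepsilon>0}\ \bigcup_{B\in L(\mathcal H),\,\|B\|<\varepsilon}W(T+B),\qquad W_\Psi(\mathbf t)=\bigcap_{\varepsilon>0}\ \bigcup_{\|\mathbf b\|<\varepsilon}W(\mathbf t+\mathbf b),$$ where $\mathbf b$ runs through the bounded sesquilinear forms on $\mathcal H$. **Theorem.** Suppose that there exist $k\in\mathbb N_0$, $\mu\in\Omega$ and a core $\mathcal D$ of $\mathbf t(\mu)$ such that $$0\notin\overline{W\big(\mathbf t^{(k)}(\mu)|_{\mathcal D}\big)}.$$ Then $$\sigma(T)\subseteq W_\Psi(\mathbf t)=\overline{W(\mathbf t)}\cap\Omega.$$ If,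 in addition, $\operatorname{dom}T(\lambda)$ is the same for all $\lambda\in\Omega$, then $$\sigma(T)\subseteq W_\Psi(T)=\overline{W(T)}\cap\Omega.$$ -/

import Mathlib

open Filter Topology

namespace PseudoNumRange

variable {H : Type*} [NormedAddCommGroup H] [InnerProductSpace ℂ H]

/-- A sesquilinear form in `H`, defined on a linear subspace `domain`;
`form f g` is `t[f, g]`, linear in `f` and conjugate-linear in `g`. -/
structure SesqForm (H : Type*) [NormedAddCommGroup H] [InnerProductSpace ℂ H] where
  /-- the domain `dom t` -/
  domain : Submodule ℂ H
  /-- the values `t[f, g]` -/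
  form : domain →ₗ[ℂ] domain →ₗ⋆[ℂ] ℂ

/-- The numerical range `{q(f) : f ∈ D, ‖f‖ = 1}` of a functional `q` (which only matters on `D`),
on a linear subspace `D`. -/
def numRangeOn (q : H → ℂ) (D : Submodule ℂ H) : Set ℂ :=
  {z | ∃ f ∈ D, ‖f‖ = 1 ∧ q f = z}

/-- The closed sector with vertex `γ` and semi-angle `ϑ`. -/
def sector (γ ϑ : ℝ) : Set ℂ :=
  {z | |(z - (γ : ℂ)).arg| ≤ ϑ}

namespace SesqForm

open Classical in
/-- The quadratic form `t[f] = t[f, f]` for `f ∈ dom t`. Outside `dom t` the value is the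
irrelevant default `0`. -/
noncomputable def quad (t : SesqForm H) (f : H) : ℂ :=
  if hf : f ∈ t.domain then t.form ⟨f, hf⟩ ⟨f, hf⟩ else 0

/-- The sum `t + b` of a form and a bounded sesquilinear form, with domain `dom t`. -/
noncomputable def addBounded (t : SesqForm H) (b : H →L[ℂ] H →L⋆[ℂ] ℂ) : SesqForm H where
  domain := t.domain
  form := LinearMap.mk₂'ₛₗ (RingHom.id ℂ) (starRingEnd ℂ)
    (fun f g => t.form f g + b (f : H) (g : H))
    (fun f f' g => by simp; ring)
    (fun c f g => by simp; ring)
    (fun f g g' => by simp; ring)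
    (fun c f g => by simp; ring)

/-- The numerical range of a form. -/
def numRange (t : SesqForm H) : Set ℂ := numRangeOn t.quad t.domain

/-- A form is sectorial if its numerical range lies in a sector of semi-angle less than `π / 2`
with a real vertex. -/
def IsSectorial (t : SesqForm H) : Prop :=
  ∃ γ ϑ : ℝ, 0 ≤ ϑ ∧ ϑ < Real.pi / 2 ∧ t.numRange ⊆ sector γ ϑ

/-- `t`-convergence of a sequence in `dom t` to `f ∈ H`: `u n → f` in `H` and
`t[u n - u m] → 0` as `n, m → ∞`. -/
def ConvergesTo (t : SesqForm H) (u : ℕ → H) (f : H) : Prop :=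
  (∀ n, u n ∈ t.domain) ∧ Tendsto u atTop (𝓝 f) ∧
    Tendsto (fun p : ℕ × ℕ => t.quad (u p.1 - u p.2)) atTop (𝓝 0)

/-- A form is closed if every `t`-convergent sequence has its limit `f` in `dom t` and
`t[u n - f] → 0`. -/
def IsClosed (t : SesqForm H) : Prop :=
  ∀ (u : ℕ → H) (f : H), t.ConvergesTo u f →
    f ∈ t.domain ∧ Tendsto (fun n => t.quad (u n - f)) atTop (𝓝 0)

/-- A linear subspace `D` of `dom t` is a core of the (closed) form `t` if every `f ∈ dom t` is
the `t`-limit of a sequence in `D`, that is, the closure of the restriction of `t` to `D` is `t`. -/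
def IsCore (t : SesqForm H) (D : Submodule ℂ H) : Prop :=
  D ≤ t.domain ∧ ∀ f ∈ t.domain, ∃ u : ℕ → H, (∀ n, u n ∈ D) ∧ t.ConvergesTo u f

/-- The graph of the operator associated with `t`: all pairs `(f, w)` with `f ∈ dom t` and
`t[f, g] = (w, g)` for every `g ∈ dom t`. Mathlib's `inner ℂ g w` is linear in `w`, so it is
the product written `(w, g)` in the convention with linear first argument. -/
def assocGraph (t : SesqForm H) : Submodule ℂ (H × H) where
  carrier := {p | ∃ hf : p.1 ∈ t.domain, ∀ g : t.domain, t.form ⟨p.1, hf⟩ g = inner ℂ (g : H) p.2}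
  zero_mem' := ⟨t.domain.zero_mem, fun g => by
    have h : (⟨0, t.domain.zero_mem⟩ : t.domain) = 0 := rfl
    simp [h]⟩
  add_mem' := by
    rintro ⟨f, w⟩ ⟨f', w'⟩ ⟨hf, h⟩ ⟨hf', h'⟩
    refine ⟨t.domain.add_mem hf hf', fun g => ?_⟩
    have e : (⟨f + f', t.domain.add_mem hf hf'⟩ : t.domain) = ⟨f, hf⟩ + ⟨f', hf'⟩ := rfl
    have h1 := h g
    have h2 := h' g
    simp only at h1 h2
    change t.form ⟨f + f', t.domain.add_mem hf hf'⟩ g = inner ℂ (g : H) (w + w')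
    rw [e, map_add, LinearMap.add_apply, h1, h2, inner_add_right]
  smul_mem' := by
    rintro c ⟨f, w⟩ ⟨hf, h⟩
    refine ⟨t.domain.smul_mem c hf, fun g => ?_⟩
    have e : (⟨c • f, t.domain.smul_mem c hf⟩ : t.domain) = c • ⟨f, hf⟩ := rfl
    have h1 := h g
    simp only at h1
    change t.form ⟨c • f, t.domain.smul_mem c hf⟩ g = inner ℂ (g : H) (c • w)
    rw [e, map_smul, LinearMap.smul_apply, h1, inner_smul_right, smul_eq_mul]

/-- The operator associated with `t`: for densely defined `t`, `f ∈ dom T` and `T f = w` if and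
only if `f ∈ dom t` and `t[f, g] = (w, g)` for all `g ∈ dom t`. For densely defined closed
sectorial `t` it is the m-sectorial operator of the first representation theorem. -/
noncomputable def assocOperator (t : SesqForm H) : H →ₗ.[ℂ] H := t.assocGraph.toLinearPMap

/-- The defining property of the associated operator of a densely defined form. -/
theorem mem_graph_assocOperator (t : SesqForm H) (ht : Dense (t.domain : Set H)) (f w : H) :
    (f, w) ∈ t.assocOperator.graph ↔
      ∃ hf : f ∈ t.domain, ∀ g : t.domain, t.form ⟨f, hf⟩ g = inner ℂ (g : H) w := by
  have hfun : ∀ x : H × H, x ∈ t.assocGraph → x.1 = 0 → x.2 = 0 := by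
    rintro ⟨f, w⟩ ⟨hf, h⟩ hf0
    obtain rfl : f = 0 := hf0
    refine ht.eq_zero_of_inner_right (𝕜 := ℂ) fun g hg => ?_
    have h1 := h ⟨g, hg⟩
    have e : (⟨0, hf⟩ : t.domain) = 0 := rfl
    simp only [e, map_zero, LinearMap.zero_apply] at h1
    exact h1.symm
  rw [assocOperator, Submodule.toLinearPMap_graph_eq _ hfun]
  rfl

end SesqForm

section FormFamilies

variable (Ω : Set ℂ) (t : ℂ → SesqForm H)

/-- Holomorphic form family of type (a) on `Ω`: densely defined closed sectorial forms with
constant domain such that `z ↦ t(z)[f]` is holomorphic on `Ω` for each `f` in the common domain.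
(The forms `t z` with `z ∉ Ω` play no role.) -/
structure IsHolomorphicTypeA : Prop where
  dense : ∀ z ∈ Ω, Dense ((t z).domain : Set H)
  closed : ∀ z ∈ Ω, (t z).IsClosed
  sectorial : ∀ z ∈ Ω, (t z).IsSectorial
  domain_eq : ∀ z ∈ Ω, ∀ w ∈ Ω, (t z).domain = (t w).domain
  holomorphic : ∀ f : H, (∀ z ∈ Ω, f ∈ (t z).domain) →
    DifferentiableOn ℂ (fun z => (t z).quad f) Ω

/-- The derivative `t⁽ᵏ⁾(μ)[f]`, the `k`-th derivative of `z ↦ t(z)[f]` at `μ`. -/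
noncomputable def derivQuad (k : ℕ) (μ : ℂ) (f : H) : ℂ :=
  iteratedDeriv k (fun z => (t z).quad f) μ

/-- The numerical range `W(t)` of a form function on `Ω`. -/
def formNumRange : Set ℂ :=
  {z | z ∈ Ω ∧ ∃ f ∈ (t z).domain, f ≠ 0 ∧ (t z).quad f = 0}

/-- The `ε`-pseudo numerical range `W_ε(t)`, the union of `W(t + b)` over bounded sesquilinear
forms `b` in `H` with `‖b‖ < ε`. -/
def formEpsNumRange (ε : ℝ) : Set ℂ :=
  ⋃ (b : H →L[ℂ] H →L⋆[ℂ] ℂ) (_ : ‖b‖ < ε), formNumRange Ω (fun z => (t z).addBounded b)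

/-- The pseudo numerical range `W_Ψ(t)` of a form function on `Ω`. -/
def formPseudoNumRange : Set ℂ := ⋂ (ε : ℝ) (_ : 0 < ε), formEpsNumRange Ω t ε

end FormFamilies

section OperatorFamilies

/-- `z ∈ ρ(A)`: the map `A - z : dom A → H` is a bijection with bounded inverse. -/
def IsResolventPoint (A : H →ₗ.[ℂ] H) (z : ℂ) : Prop :=
  ∃ R : H →L[ℂ] H,
    (∀ w : H, ∃ h : R w ∈ A.domain, A ⟨R w, h⟩ - z • R w = w) ∧
    ∀ f : A.domain, R (A f - z • (f : H)) = f

/-- The spectrum of a linear operator in `H`. -/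
def opSpectrum (A : H →ₗ.[ℂ] H) : Set ℂ := {z | ¬ IsResolventPoint A z}

variable (Ω : Set ℂ) (T : ℂ → H →ₗ.[ℂ] H)

/-- The spectrum `σ(T)` of an operator function on `Ω`. -/
def famSpectrum : Set ℂ := {z | z ∈ Ω ∧ (0 : ℂ) ∈ opSpectrum (T z)}

/-- The numerical range `W(T)` of an operator function on `Ω`. -/
def opNumRange : Set ℂ :=
  {z | z ∈ Ω ∧ ∃ f : (T z).domain, (f : H) ≠ 0 ∧ inner ℂ (f : H) (T z f) = 0}

/-- The `ε`-pseudo numerical range `W_ε(T)`, the union of `W(T + B)` over bounded operators `B`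
in `H` with `‖B‖ < ε`; here `B +ᵥ A` is the operator `A + B` with domain `dom A`. -/
def opEpsNumRange (ε : ℝ) : Set ℂ :=
  ⋃ (B : H →L[ℂ] H) (_ : ‖B‖ < ε), opNumRange Ω (fun z => (B : H →ₗ[ℂ] H) +ᵥ T z)

/-- The pseudo numerical range `W_Ψ(T)` of an operator function on `Ω`. -/
def opPseudoNumRange : Set ℂ := ⋂ (ε : ℝ) (_ : 0 < ε), opEpsNumRange Ω T ε

/-- The operator family `T` is the family associated with the form family `t` on `Ω`; it is
holomorphic of type (B) if `t` is holomorphic of type (a). -/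
def IsAssociatedFamily (t : ℂ → SesqForm H) : Prop :=
  ∀ z ∈ Ω, T z = (t z).assocOperator

/-- The operators `T z`, `z ∈ Ω`, all have the same domain. -/
def HasConstantDomain : Prop :=
  ∀ z ∈ Ω, ∀ w ∈ Ω, (T z).domain = (T w).domain

end OperatorFamilies

end PseudoNumRange

/-!
The pseudo numerical ranges have simple descriptions: perturbing by a multiple of the inner product
shows that `z ∈ W_Ψ(t)` if and only if `0` lies in the closure of the numerical range of the single
form `t z` (`formPseudoNumRange_eq`), and likewise for `T` (`opPseudoNumRange_eq`). The latter two
sets coincide because `dom T(z)` is dense in `dom t(z)` for the form norm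
(`FormSpace.dense_domain_assocOperator`).

*Spectral inclusion.* If `0` has positive distance from the numerical range of `t z`, then
`|t[f]| ≥ δ‖f‖²`, and since the square of the form norm is `Re t[f] + (1 - γ)‖f‖²`, also
`|t[f]| ≥ c‖f‖²` with the form norm on the right. The Lax–Milgram lemma, for which coercivity of the
modulus suffices, gives the bounded inverse of `T(z)` (`FormSpace.isResolventPoint_zero`); convexity
of the numerical range is not needed.

*Closure of the numerical range.* By the closed graph theorem and the uniform boundedness principle
the forms are locally uniformly bounded relative to each other:
`|t(z)[f]| ≤ C (|t(z₀)[f]| + ‖f‖²)` for `z` in a compact set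
(`IsHolomorphicTypeA.exists_norm_quad_le_quad`). Cauchy's estimate turns this into a Lipschitz
estimate, so that a zero of `z ↦ t(z)[f]` near `z₀` forces `t(z₀)[f]` to be small
(`IsHolomorphicTypeA.exists_norm_quad_lt`). Conversely, suppose that `t(z₀)[f n] → 0` for unit
vectors `f n`, while no `z ↦ t(z)[f n]` has a zero in a fixed neighbourhood of `z₀`. These functions
are locally bounded, so by Montel's theorem they converge along an ultrafilter, and by Hurwitz's
theorem the limit vanishes identically on the connected set `Ω`. But the hypothesis on `t⁽ᵏ⁾(μ)`,
extended from the core to the whole domain (`IsHolomorphicTypeA.norm_derivQuad_ge`), keeps the `k`-th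
derivatives at `μ` away from `0` (`IsHolomorphicTypeA.mem_closure_zeros`). The argument applies to
vectors from any fixed subset of the domain; taking them from `dom T(z₀)` gives the operator version
when this domain does not depend on the parameter.
-/

namespace PseudoNumRange

/-! ### Locally bounded families of holomorphic functions -/

section Holomorphic

variable {ι : Type*} {l : Filter ι} {F : ι → ℂ → ℂ} {h : ℂ → ℂ} {U : Set ℂ}

/-- Cauchy's estimate for the derivative, integrated: a holomorphic function bounded by `C` on a disc
of radius `2 r` satisfies a Lipschitz estimate with constant `C / r` on the disc of radius `r`. -/
theorem norm_sub_le_of_norm_le_closedBall {g : ℂ → ℂ} (hU : IsOpen U)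
    (hg : DifferentiableOn ℂ g U) {x : ℂ} {r C : ℝ} (hr : 0 < r)
    (hK : Metric.closedBall x (2 * r) ⊆ U) (hC : ∀ z ∈ Metric.closedBall x (2 * r), ‖g z‖ ≤ C)
    {y : ℂ} (hy : y ∈ Metric.ball x r) : ‖g y - g x‖ ≤ C / r * ‖y - x‖ := by
  refine (convex_ball x r).norm_image_sub_le_of_norm_deriv_le (f := g) (𝕜 := ℂ)
    (fun z hz => ?_) (fun z hz => ?_) (Metric.mem_ball_self hr) hy
  · refine hg.differentiableAt (hU.mem_nhds (hK ?_))
    rw [Metric.mem_ball] at hz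
    rw [Metric.mem_closedBall]; linarith
  · rw [Metric.mem_ball] at hz
    have hsub : Metric.closedBall z r ⊆ Metric.closedBall x (2 * r) :=
      Metric.closedBall_subset_closedBall' (by linarith)
    refine Complex.norm_deriv_le_of_forall_mem_sphere_norm_le hr ?_ fun w hw =>
      hC w (hsub (Metric.sphere_subset_closedBall hw))
    refine DifferentiableOn.diffContOnCl (hg.mono ?_)
    exact (Metric.closure_ball_subset_closedBall.trans hsub).trans hK

/-- For a locally bounded family of holomorphic functions pointwise convergence is locally uniform,
because Cauchy's estimate makes the family locally uniformly Lipschitz. -/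
theorem tendstoLocallyUniformlyOn_of_pointwise [l.NeBot] (hU : IsOpen U)
    (hF : ∀ i, DifferentiableOn ℂ (F i) U)
    (hb : ∀ K ⊆ U, IsCompact K → ∃ C, ∀ i, ∀ z ∈ K, ‖F i z‖ ≤ C)
    (hlim : ∀ z ∈ U, Tendsto (fun i => F i z) l (𝓝 (h z))) :
    TendstoLocallyUniformlyOn F h l U := by
  rw [Metric.tendstoLocallyUniformlyOn_iff]
  intro ε hε x hx
  obtain ⟨R, hR, hRU⟩ := Metric.isOpen_iff.1 hU x hx
  set r := R / 3 with hr
  have hr0 : 0 < r := by positivity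
  have hK : Metric.closedBall x (2 * r) ⊆ U :=
    (Metric.closedBall_subset_ball (by linarith)).trans hRU
  obtain ⟨C, hC⟩ := hb _ hK (isCompact_closedBall _ _)
  have hLip : ∀ i, ∀ y ∈ Metric.ball x r, ‖F i y - F i x‖ ≤ C / r * ‖y - x‖ := fun i y hy =>
    norm_sub_le_of_norm_le_closedBall hU (hF i) hr0 hK (hC i) hy
  have hC0 : 0 ≤ C := by
    obtain ⟨i⟩ := l.nonempty_of_neBot
    exact (norm_nonneg _).trans (hC i x (Metric.mem_closedBall_self (by positivity)))
  have hLip' : ∀ y ∈ Metric.ball x r, ‖h y - h x‖ ≤ C / r * ‖y - x‖ := by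
    intro y hy
    have hyU : y ∈ U := hK (Metric.ball_subset_closedBall
      (Metric.ball_subset_ball (by linarith) hy))
    exact le_of_tendsto ((hlim y hyU).sub (hlim x hx)).norm (Eventually.of_forall fun i =>
      hLip i y hy)
  set L := C / r with hL
  have hL0 : 0 ≤ L := by positivity
  refine ⟨Metric.ball x (min r (ε / (3 * (L + 1)))),
    mem_nhdsWithin_of_mem_nhds (Metric.ball_mem_nhds _ (by positivity)), ?_⟩
  filter_upwards [Metric.tendsto_nhds.1 (hlim x hx) (ε / 3) (by positivity)] with i hi y hy
  have hy1 : y ∈ Metric.ball x r := Metric.ball_subset_ball (min_le_left _ _) hy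
  have hy2 : ‖y - x‖ < ε / (3 * (L + 1)) := by
    rw [← dist_eq_norm]
    exact (Metric.mem_ball.1 hy).trans_le (min_le_right _ _)
  have h1 : L * ‖y - x‖ ≤ ε / 3 := by
    calc L * ‖y - x‖ ≤ (L + 1) * (ε / (3 * (L + 1))) := by gcongr; linarith
      _ = ε / 3 := by field_simp
  rw [dist_eq_norm] at hi ⊢
  calc ‖h y - F i y‖ = ‖(h y - h x) - (F i x - h x) - (F i y - F i x)‖ := by congr 1; ring
    _ ≤ ‖h y - h x‖ + ‖F i x - h x‖ + ‖F i y - F i x‖ :=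
      (norm_sub_le _ _).trans (by gcongr; exact norm_sub_le _ _)
    _ < ε := by linarith [hLip i y hy1, hLip' y hy1]

theorem _root_.TendstoLocallyUniformlyOn.iteratedDeriv [l.NeBot] (hU : IsOpen U)
    (hF : ∀ i, DifferentiableOn ℂ (F i) U) (hlim : TendstoLocallyUniformlyOn F h l U) (k : ℕ) :
    TendstoLocallyUniformlyOn (fun i => iteratedDeriv k (F i)) (iteratedDeriv k h) l U := by
  induction k generalizing F h with
  | zero => simpa [iteratedDeriv_zero] using hlim
  | succ k ih =>
    simp only [iteratedDeriv_succ']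
    exact ih (fun i => (hF i).deriv hU) (hlim.deriv (Eventually.of_forall hF) hU)

/-- **Hurwitz's theorem** in the form: a locally uniform limit of holomorphic functions without
zeros near a point, which itself vanishes at this point, is identically zero. -/
theorem eqOn_zero_of_tendstoLocallyUniformlyOn [l.NeBot] (hU : IsOpen U) (hUc : IsPreconnected U)
    (hF : ∀ i, DifferentiableOn ℂ (F i) U) (hlim : TendstoLocallyUniformlyOn F h l U)
    {z₀ : ℂ} (hz₀ : z₀ ∈ U) (h0 : h z₀ = 0) {r : ℝ} (hr : 0 < r)
    (hne : ∀ i, ∀ z ∈ Metric.ball z₀ r ∩ U, F i z ≠ 0) : Set.EqOn h 0 U := by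
  have hh : DifferentiableOn ℂ h U := hlim.differentiableOn (Eventually.of_forall hF) hU
  have hA : AnalyticOnNhd ℂ h U := hh.analyticOnNhd hU
  rcases (hA z₀ hz₀).eventually_eq_zero_or_eventually_ne_zero with hev | hev
  · exact hA.eqOn_zero_of_preconnected_of_eventuallyEq_zero hUc hz₀ hev
  exfalso
  rw [eventually_nhdsWithin_iff] at hev
  have hevU : ∀ᶠ z in 𝓝 z₀, z ∈ U := hU.mem_nhds hz₀
  have hevr : ∀ᶠ z in 𝓝 z₀, z ∈ Metric.ball z₀ r := Metric.ball_mem_nhds z₀ hr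
  obtain ⟨R, hR, hRsub⟩ := Metric.eventually_nhds_iff_ball.1 (hev.and (hevU.and hevr))
  set ρ := R / 2 with hρ
  have hρ0 : 0 < ρ := by positivity
  have hcb : Metric.closedBall z₀ ρ ⊆ Metric.ball z₀ R :=
    Metric.closedBall_subset_ball (by linarith)
  have hsph : IsCompact (Metric.sphere z₀ ρ) := isCompact_sphere _ _
  have hsne : (Metric.sphere z₀ ρ).Nonempty := NormedSpace.sphere_nonempty.2 hρ0.le
  have hsU : Metric.sphere z₀ ρ ⊆ U := fun z hz =>
    (hRsub z (hcb (Metric.sphere_subset_closedBall hz))).2.1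
  obtain ⟨w, hw, hmin⟩ := hsph.exists_isMinOn hsne (hh.continuousOn.mono hsU).norm
  set m := ‖h w‖ with hm
  have hm0 : 0 < m := by
    refine norm_pos_iff.2 ((hRsub w (hcb (Metric.sphere_subset_closedBall hw))).1 ?_)
    exact Metric.ne_of_mem_sphere hw hρ0.ne'
  have hunif := (tendstoLocallyUniformlyOn_iff_forall_isCompact hU).1 hlim _ hsU hsph
  rw [Metric.tendstoUniformlyOn_iff] at hunif
  have hpt := Metric.tendsto_nhds.1 (hlim.tendsto_at hz₀) (m / 2) (by positivity)
  obtain ⟨i, hi1, hi2⟩ := ((hunif (m / 2) (by positivity)).and hpt).exists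
  have hnz : ∀ z ∈ Metric.closedBall z₀ ρ, F i z ≠ 0 := fun z hz =>
    hne i z ⟨(hRsub z (hcb hz)).2.2, (hRsub z (hcb hz)).2.1⟩
  have hd : DiffContOnCl ℂ (fun z => (F i z)⁻¹) (Metric.ball z₀ ρ) := by
    refine DifferentiableOn.diffContOnCl ?_
    refine (((hF i).mono fun z hz => ?_).inv fun z hz => ?_)
    · exact (hRsub z (hcb (Metric.closure_ball_subset_closedBall hz))).2.1
    · exact hnz z (Metric.closure_ball_subset_closedBall hz)
  -- The maximum principle for `1 / F i` bounds `F i z₀` from below by its values on the circle.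
  have hmax := Complex.norm_le_of_forall_mem_frontier_norm_le (C := 2 / m) Metric.isBounded_ball hd
    (fun z hz => ?_) (subset_closure (Metric.mem_ball_self hρ0))
  · rw [h0, dist_zero_right] at hi2
    have hpos : 0 < ‖F i z₀‖ := norm_pos_iff.2 (hnz z₀ (Metric.mem_closedBall_self hρ0.le))
    rw [norm_inv, inv_le_comm₀ hpos (by positivity), inv_div] at hmax
    linarith
  · rw [frontier_ball _ hρ0.ne'] at hz
    have h1 : m ≤ ‖h z‖ := hmin hz
    have h2 := hi1 z hz
    rw [dist_eq_norm] at h2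
    have h3 : m / 2 ≤ ‖F i z‖ := by
      have := norm_sub_norm_le (h z) (F i z)
      linarith
    rw [norm_inv, inv_le_comm₀ (by linarith) (by positivity), inv_div]
    exact h3

/-- **Montel's theorem** along an ultrafilter: a locally bounded family of holomorphic functions
converges locally uniformly. -/
theorem exists_tendstoLocallyUniformlyOn_ultrafilter (𝒰 : Ultrafilter ι) (hU : IsOpen U)
    (hF : ∀ i, DifferentiableOn ℂ (F i) U)
    (hb : ∀ K ⊆ U, IsCompact K → ∃ C, ∀ i, ∀ z ∈ K, ‖F i z‖ ≤ C) :
    ∃ h : ℂ → ℂ, TendstoLocallyUniformlyOn F h 𝒰 U := by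
  have hpt : ∀ z, ∃ a, z ∈ U → Tendsto (fun i => F i z) 𝒰 (𝓝 a) := by
    intro z
    by_cases hz : z ∈ U
    · obtain ⟨C, hC⟩ := hb {z} (by simpa using hz) isCompact_singleton
      obtain ⟨a, -, ha⟩ := (isCompact_closedBall (0 : ℂ) C).ultrafilter_le_nhds
        (𝒰.map fun i => F i z) (by
          rw [le_principal_iff]
          exact mem_map.2 (univ_mem' fun i => by simpa using hC i z rfl))
      exact ⟨a, fun _ => ha⟩
    · exact ⟨0, fun h => absurd h hz⟩
  choose h hh using hpt
  exact ⟨h, tendstoLocallyUniformlyOn_of_pointwise hU hF hb hh⟩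

end Holomorphic

variable {H : Type*} [NormedAddCommGroup H] [InnerProductSpace ℂ H]

/-! ### Sesquilinear forms and bounded operators -/

section Bounded

variable {V : Type*} [NormedAddCommGroup V] [InnerProductSpace ℂ V]

theorem sesq_polarization (φ : V →ₗ[ℂ] V →ₗ⋆[ℂ] ℂ) (u v : V) :
    φ u v = (φ (u + v) (u + v) - φ (u - v) (u - v)
      + Complex.I * φ (u + Complex.I • v) (u + Complex.I • v)
      - Complex.I * φ (u - Complex.I • v) (u - Complex.I • v)) / 4 := by
  simp only [map_add, map_sub, LinearMap.add_apply, LinearMap.sub_apply,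
    LinearMap.smul_apply, LinearMap.map_smulₛₗ, RingHom.id_apply, Complex.conj_I, smul_eq_mul]
  linear_combination (1 / 2 * φ u v - 1 / 2 * φ v u) * Complex.I_sq

/-- The polarization identity as an estimate, by which pointwise and norm bounds pass from quadratic
to sesquilinear forms. -/
theorem norm_sesq_le (φ : V →ₗ[ℂ] V →ₗ⋆[ℂ] ℂ) (u v : V) :
    4 * ‖φ u v‖ ≤ ‖φ (u + v) (u + v)‖ + ‖φ (u - v) (u - v)‖
      + ‖φ (u + Complex.I • v) (u + Complex.I • v)‖
      + ‖φ (u - Complex.I • v) (u - Complex.I • v)‖ := by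
  have : ∀ a b c d : ℂ, ‖a - b + Complex.I * c - Complex.I * d‖ ≤ ‖a‖ + ‖b‖ + ‖c‖ + ‖d‖ := by
    intro a b c d
    calc _ ≤ ‖a - b + Complex.I * c‖ + ‖Complex.I * d‖ := norm_sub_le _ _
      _ ≤ ‖a - b‖ + ‖Complex.I * c‖ + ‖Complex.I * d‖ := by gcongr; exact norm_add_le _ _
      _ ≤ _ := by
        simp only [norm_mul, Complex.norm_I, one_mul]
        gcongr; exact norm_sub_le _ _
  refine le_trans (le_of_eq ?_) (this _ _ _ _)
  rw [sesq_polarization, norm_div, RCLike.norm_ofNat]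
  ring

theorem norm_sesq_le_of_quadratic (φ : V →ₗ[ℂ] V →ₗ⋆[ℂ] ℂ) {C : ℝ}
    (hC : ∀ u, ‖φ u u‖ ≤ C * ‖u‖ ^ 2) (u v : V) : ‖φ u v‖ ≤ 4 * C * ‖u‖ * ‖v‖ := by
  have hunit : ∀ u v : V, ‖u‖ = 1 → ‖v‖ = 1 → ‖φ u v‖ ≤ 4 * C := by
    intro u v hu hv
    have hC0 : 0 ≤ C := by simpa [hu] using (norm_nonneg _).trans (hC u)
    have key : ∀ w : V, ‖w‖ ≤ 2 → ‖φ w w‖ ≤ 4 * C := fun w hw => by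
      refine (hC w).trans ?_
      nlinarith [norm_nonneg w, pow_le_pow_left₀ (norm_nonneg w) hw 2]
    have hIv : ‖Complex.I • v‖ = 1 := by rw [norm_smul, Complex.norm_I, hv, one_mul]
    have h1 := key (u + v) ((norm_add_le _ _).trans (by linarith))
    have h2 := key (u - v) ((norm_sub_le _ _).trans (by linarith))
    have h3 := key (u + Complex.I • v) ((norm_add_le _ _).trans (by linarith))
    have h4 := key (u - Complex.I • v) ((norm_sub_le _ _).trans (by linarith))
    linarith [norm_sesq_le φ u v]
  rcases eq_or_ne u 0 with rfl | hu
  · simp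
  rcases eq_or_ne v 0 with rfl | hv
  · simp
  have hu' := norm_pos_iff.2 hu
  have hv' := norm_pos_iff.2 hv
  have h := hunit (((‖u‖ : ℂ)⁻¹) • u) (((‖v‖ : ℂ)⁻¹) • v)
    (by simp [norm_smul, hu'.ne']) (by simp [norm_smul, hv'.ne'])
  simp only [LinearMap.smul_apply, LinearMap.map_smulₛₗ, RingHom.id_apply, norm_smul,
    norm_inv, RCLike.norm_conj, Complex.norm_real, norm_norm, map_inv₀] at h
  rw [inv_mul_le_iff₀ hv', inv_mul_le_iff₀ hu'] at h
  linarith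

/-- A sesquilinear form with bounded quadratic form is represented by a bounded operator. -/
theorem exists_clm_of_sesq [CompleteSpace V] (φ : V →ₗ[ℂ] V →ₗ⋆[ℂ] ℂ) {C : ℝ}
    (hC : ∀ u, ‖φ u u‖ ≤ C * ‖u‖ ^ 2) :
    ∃ A : V →L[ℂ] V, ∀ u v, inner ℂ v (A u) = φ u v := by
  let B : V →L⋆[ℂ] V →L[ℂ] ℂ := φ.flip.mkContinuous₂ (4 * C) fun v u => by
    rw [LinearMap.flip_apply]
    linarith [norm_sesq_le_of_quadratic φ hC u v]
  refine ⟨ContinuousLinearMap.adjoint (InnerProductSpace.continuousLinearMapOfBilin B),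
    fun u v => ?_⟩
  rw [ContinuousLinearMap.adjoint_inner_right,
    InnerProductSpace.continuousLinearMapOfBilin_apply]
  rfl

/-- The **Lax–Milgram lemma**, with coercivity of the modulus of the quadratic form. -/
theorem exists_equiv_of_norm_inner_ge [CompleteSpace V] (A : V →L[ℂ] V) {c : ℝ} (hc : 0 < c)
    (hA : ∀ u, c * ‖u‖ ^ 2 ≤ ‖inner ℂ u (A u)‖) :
    ∃ e : V ≃L[ℂ] V, ∀ u, e u = A u := by
  have hbelow : ∀ u, c * ‖u‖ ≤ ‖A u‖ := by
    intro u
    rcases eq_or_ne u 0 with rfl | hu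
    · simp
    have hu' := norm_pos_iff.2 hu
    have := (hA u).trans (norm_inner_le_norm u (A u))
    nlinarith
  have hanti : AntilipschitzWith (c⁻¹).toNNReal A := by
    refine ContinuousLinearMap.antilipschitz_of_bound A fun u => ?_
    rw [Real.coe_toNNReal _ (inv_pos.2 hc).le, inv_mul_eq_div, le_div_iff₀ hc]
    linarith [hbelow u]
  have hcl : IsClosed (A.range : Set V) := hanti.isClosed_range A.uniformContinuous
  have hker : A.ker = ⊥ := LinearMap.ker_eq_bot.2 hanti.injective
  have hrange : A.range = ⊤ := by
    have := hcl.completeSpace_coe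
    rw [← Submodule.orthogonal_eq_bot_iff, Submodule.eq_bot_iff]
    intro w hw
    have h0 : inner ℂ w (A w) = 0 := Submodule.inner_left_of_mem_orthogonal
      (LinearMap.mem_range_self (A : V →ₗ[ℂ] V) w) hw
    have h1 := hA w
    rw [h0, norm_zero] at h1
    have : ‖w‖ ^ 2 ≤ 0 := by nlinarith
    exact norm_eq_zero.1 (pow_eq_zero_iff (two_ne_zero) |>.1 (le_antisymm this (by positivity)))
  exact ⟨ContinuousLinearEquiv.ofBijective A hker hrange, fun u => rfl⟩

end Bounded

/-! ### The form norm -/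

namespace SesqForm

/-- Sectoriality in the form in which it is used: `|t[f] - γ‖f‖²| ≤ M (Re t[f] - γ‖f‖²)`, where
`M = 1 / cos ϑ` for a sector of semi-angle `ϑ`. -/
def IsSectorialWith (t : SesqForm H) (γ M : ℝ) : Prop :=
  ∀ f : t.domain, 0 ≤ (t.form f f).re - γ * ‖(f : H)‖ ^ 2 ∧
    ‖t.form f f - (γ * ‖(f : H)‖ ^ 2 : ℝ)‖ ≤ M * ((t.form f f).re - γ * ‖(f : H)‖ ^ 2)

theorem quad_coe (t : SesqForm H) (f : t.domain) : t.quad f = t.form f f := by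
  simp [quad]

theorem quad_smul (t : SesqForm H) (c : ℂ) {f : H} (hf : f ∈ t.domain) :
    t.quad (c • f) = (‖c‖ : ℂ) ^ 2 * t.quad f := by
  have h := t.quad_coe (c • ⟨f, hf⟩)
  have h' := t.quad_coe ⟨f, hf⟩
  simp only [LinearMap.smul_apply, LinearMap.map_smulₛₗ, RingHom.id_apply, smul_eq_mul] at h
  rw [← h'] at h
  rw [← Complex.conj_mul', mul_assoc]
  exact h

theorem quad_zero (t : SesqForm H) : t.quad 0 = 0 := by
  have h := t.quad_coe 0
  simpa using h

theorem IsSectorial.exists_isSectorialWith {t : SesqForm H} (ht : t.IsSectorial) :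
    ∃ γ M : ℝ, t.IsSectorialWith γ M := by
  obtain ⟨γ, ϑ, h0, h2, hsub⟩ := ht
  have hcos : 0 < Real.cos ϑ := Real.cos_pos_of_mem_Ioo ⟨by linarith [Real.pi_pos], h2⟩
  have hsector : ∀ z ∈ sector γ ϑ, Real.cos ϑ * ‖z - γ‖ ≤ z.re - γ := by
    intro z hz
    have h3 : Real.cos ϑ ≤ Real.cos (z - γ).arg := by
      rw [← Real.cos_abs (z - γ).arg]
      exact Real.cos_le_cos_of_nonneg_of_le_pi (abs_nonneg _) (by linarith [Real.pi_pos]) hz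
    have h4 : ‖z - γ‖ * Real.cos (z - γ).arg = z.re - γ := by
      rw [Complex.norm_mul_cos_arg]; simp
    rw [← h4, mul_comm]
    gcongr
  refine ⟨γ, (Real.cos ϑ)⁻¹, fun f => ?_⟩
  suffices h : Real.cos ϑ * ‖t.form f f - (γ * ‖(f : H)‖ ^ 2 : ℝ)‖ ≤
      (t.form f f).re - γ * ‖(f : H)‖ ^ 2 by
    refine ⟨(by positivity : (0 : ℝ) ≤ _).trans h, ?_⟩
    rwa [inv_mul_eq_div, le_div_iff₀ hcos, mul_comm]
  rcases eq_or_ne f 0 with rfl | hf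
  · simp
  have hf' : 0 < ‖(f : H)‖ := norm_pos_iff.2 (by simpa using hf)
  have hmem : t.quad ((‖(f : H)‖⁻¹ : ℂ) • (f : H)) ∈ t.numRange :=
    ⟨_, t.domain.smul_mem _ f.2, by simp [norm_smul, hf'.ne'], rfl⟩
  have h5 := hsector _ (hsub hmem)
  rw [t.quad_smul _ f.2, t.quad_coe] at h5
  set n := ‖(f : H)‖
  have e1 : ((‖(n : ℂ)⁻¹‖ : ℝ) : ℂ) ^ 2 * t.form f f - γ
      = ((n ^ 2)⁻¹ : ℝ) * (t.form f f - (γ * n ^ 2 : ℝ)) := by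
    have : (n : ℂ) ≠ 0 := by exact_mod_cast hf'.ne'
    simp [abs_of_pos hf']
    field_simp
  have e2 : (((‖(n : ℂ)⁻¹‖ : ℝ) : ℂ) ^ 2 * t.form f f).re - γ
      = (n ^ 2)⁻¹ * ((t.form f f).re - γ * n ^ 2) := by
    have := congrArg Complex.re e1
    rw [Complex.sub_re, Complex.ofReal_re, Complex.re_ofReal_mul, Complex.sub_re,
      Complex.ofReal_re] at this
    exact this
  rw [e1, e2, norm_mul, Complex.norm_real, Real.norm_of_nonneg (by positivity),
    mul_left_comm] at h5
  exact le_of_mul_le_mul_left h5 (by positivity)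

/-- The domain of a sectorial form `t` with vertex `γ` as a pre-Hilbert space; its inner product is
the Hermitian part of `t + (1 - γ)`. The shift by `1 - γ` makes the form norm dominate the norm of
`H`. -/
def FormSpace {t : SesqForm H} {γ M : ℝ} (_h : t.IsSectorialWith γ M) : Type _ := t.domain

namespace FormSpace

variable {t : SesqForm H} {γ M : ℝ} (h : t.IsSectorialWith γ M)

noncomputable instance : AddCommGroup (FormSpace h) := inferInstanceAs (AddCommGroup t.domain)

noncomputable instance : Module ℂ (FormSpace h) := inferInstanceAs (Module ℂ t.domain)

/-- The identity map from the form space of `t` to the domain of `t`. -/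
noncomputable def toDomain : FormSpace h ≃ₗ[ℂ] t.domain := LinearEquiv.refl ℂ t.domain

/-- The inner product of the form space. -/
noncomputable def formInner (u v : FormSpace h) : ℂ :=
  (t.form (toDomain h v) (toDomain h u)
    + starRingEnd ℂ (t.form (toDomain h u) (toDomain h v))) / 2
    + (1 - γ : ℂ) * inner ℂ (toDomain h u : H) (toDomain h v)

theorem formInner_self (u : FormSpace h) : formInner h u u =
    (((t.form (toDomain h u) (toDomain h u)).re + (1 - γ) * ‖(toDomain h u : H)‖ ^ 2 : ℝ) : ℂ) := by
  rw [formInner, inner_self_eq_norm_sq_to_K, Complex.add_conj]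
  simp

theorem norm_sq_le_formInner_self (u : FormSpace h) :
    ‖(toDomain h u : H)‖ ^ 2 ≤ (formInner h u u).re := by
  rw [formInner_self, Complex.ofReal_re]
  linarith [(h (toDomain h u)).1]

/-- The form space satisfies the axioms of a pre-Hilbert space. -/
noncomputable abbrev core : InnerProductSpace.Core ℂ (FormSpace h) where
  inner u v := formInner h u v
  conj_inner_symm u v := by
    simp only [formInner, map_add, map_div₀, map_mul, map_sub, map_one, Complex.conj_ofReal,
      Complex.conj_conj, inner_conj_symm, map_ofNat]
    ring
  re_inner_nonneg u := (sq_nonneg _).trans (norm_sq_le_formInner_self h u)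
  add_left u v w := by
    simp only [formInner, map_add, LinearMap.add_apply, Submodule.coe_add, inner_add_left]
    ring
  smul_left u v c := by
    simp only [formInner, map_smul, LinearMap.smul_apply, LinearMap.map_smulₛₗ,
      Submodule.coe_smul, inner_smul_left, smul_eq_mul, map_mul]
    ring
  definite u hu := by
    have h1 := norm_sq_le_formInner_self h u
    rw [hu, Complex.zero_re] at h1
    have h4 : toDomain h u = 0 := by simpa using le_antisymm h1 (sq_nonneg _)
    exact (LinearEquiv.map_eq_zero_iff _).1 h4

noncomputable instance : NormedAddCommGroup (FormSpace h) :=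
  letI := core h
  InnerProductSpace.Core.toNormedAddCommGroup (𝕜 := ℂ)

noncomputable instance : InnerProductSpace ℂ (FormSpace h) :=
  InnerProductSpace.ofCore (core h).toCore

theorem norm_sq (u : FormSpace h) : ‖u‖ ^ 2 =
    (t.form (toDomain h u) (toDomain h u)).re + (1 - γ) * ‖(toDomain h u : H)‖ ^ 2 := by
  rw [← inner_self_eq_norm_sq (𝕜 := ℂ)]
  change (formInner h u u).re = _
  rw [formInner_self, Complex.ofReal_re]

theorem norm_toDomain_le (u : FormSpace h) : ‖(toDomain h u : H)‖ ≤ ‖u‖ := by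
  refine le_of_sq_le_sq ?_ (norm_nonneg _)
  rw [norm_sq]
  linarith [(h (toDomain h u)).1]

/-- The continuous inclusion of the form space into `H`. -/
noncomputable def incl : FormSpace h →L[ℂ] H :=
  (t.domain.subtype ∘ₗ (toDomain h).toLinearMap).mkContinuous 1 fun u => by
    rw [one_mul]; exact norm_toDomain_le h u

theorem incl_apply (u : FormSpace h) : incl h u = toDomain h u := rfl

theorem incl_injective : Function.Injective (incl h) := fun _ _ huv =>
  (toDomain h).injective (Subtype.ext huv)

theorem incl_mem (u : FormSpace h) : incl h u ∈ t.domain := (toDomain h u).2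

theorem exists_incl_eq {f : H} (hf : f ∈ t.domain) : ∃ u : FormSpace h, incl h u = f :=
  ⟨(toDomain h).symm ⟨f, hf⟩, by rw [incl_apply, LinearEquiv.apply_symm_apply]⟩

theorem quad_incl (u : FormSpace h) :
    t.quad (incl h u) = t.form (toDomain h u) (toDomain h u) := t.quad_coe _

theorem norm_sq_le_quad (u : FormSpace h) :
    ‖u‖ ^ 2 ≤ ‖t.quad (incl h u)‖ + |1 - γ| * ‖incl h u‖ ^ 2 := by
  rw [norm_sq, ← quad_incl, ← incl_apply]
  gcongr
  · exact Complex.re_le_norm _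
  · exact le_abs_self _

theorem norm_quad_le (u : FormSpace h) :
    ‖t.quad (incl h u)‖ ≤ (max M 0 + |γ|) * ‖u‖ ^ 2 := by
  obtain ⟨h1, h2⟩ := h (toDomain h u)
  have h3 := norm_sq h u
  have h4 : ‖(toDomain h u : H)‖ ^ 2 ≤ ‖u‖ ^ 2 := by gcongr; exact norm_toDomain_le h u
  rw [quad_incl]
  calc ‖t.form (toDomain h u) (toDomain h u)‖
      ≤ ‖t.form (toDomain h u) (toDomain h u) - (γ * ‖(toDomain h u : H)‖ ^ 2 : ℝ)‖
        + ‖((γ * ‖(toDomain h u : H)‖ ^ 2 : ℝ) : ℂ)‖ :=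
        norm_le_norm_sub_add _ _
    _ ≤ max M 0 * ‖u‖ ^ 2 + |γ| * ‖u‖ ^ 2 := by
        gcongr
        · refine h2.trans ((mul_le_mul_of_nonneg_right (le_max_left M 0) h1).trans ?_)
          gcongr
          linarith [sq_nonneg ‖(toDomain h u : H)‖]
        · rw [Complex.norm_real, norm_mul, Real.norm_eq_abs, norm_pow, norm_norm]
          gcongr
    _ = _ := by ring

/-- Convergence in the form norm is convergence in `H` together with `t[u n - v] → 0`. -/
theorem tendsto_of_tendsto_quad {u : ℕ → FormSpace h} {v : FormSpace h}
    (h1 : Tendsto (fun n => incl h (u n)) atTop (𝓝 (incl h v)))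
    (h2 : Tendsto (fun n => t.quad (incl h (u n) - incl h v)) atTop (𝓝 0)) :
    Tendsto u atTop (𝓝 v) := by
  have h3 : Tendsto (fun n => ‖t.quad (incl h (u n - v))‖
      + |1 - γ| * ‖incl h (u n - v)‖ ^ 2) atTop (𝓝 0) := by
    have h4 : Tendsto (fun n => ‖incl h (u n) - incl h v‖) atTop (𝓝 0) :=
      (tendsto_iff_norm_sub_tendsto_zero).1 h1
    simpa using h2.norm.add ((h4.pow 2).const_mul |1 - γ|)
  have h5 : Tendsto (fun n => ‖u n - v‖ ^ 2) atTop (𝓝 0) :=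
    squeeze_zero (fun n => sq_nonneg _) (fun n => norm_sq_le_quad h _) h3
  rw [tendsto_iff_norm_sub_tendsto_zero]
  simpa using h5.sqrt

/-- The form space of a closed form is a Hilbert space. -/
theorem completeSpace [CompleteSpace H] (hc : t.IsClosed) : CompleteSpace (FormSpace h) := by
  refine Metric.complete_of_cauchySeq_tendsto fun u hu => ?_
  obtain ⟨f, hf⟩ := cauchySeq_tendsto_of_complete 
    ((incl h).uniformContinuous.comp_cauchySeq hu)
  have hconv : t.ConvergesTo (fun n => incl h (u n)) f := by
    refine ⟨fun n => incl_mem h _, hf, ?_⟩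
    have h1 : Tendsto (fun p : ℕ × ℕ => ‖u p.1 - u p.2‖) atTop (𝓝 0) := by
      have := cauchySeq_iff_tendsto_dist_atTop_0.1 hu
      simpa only [dist_eq_norm] using this
    have h2 : Tendsto (fun p : ℕ × ℕ => (max M 0 + |γ|) * ‖u p.1 - u p.2‖ ^ 2) atTop (𝓝 0) := by
      simpa using (h1.pow 2).const_mul (max M 0 + |γ|)
    refine squeeze_zero_norm (fun p => ?_) h2
    rw [← map_sub]
    exact norm_quad_le h _
  obtain ⟨hfd, hq⟩ := hc _ _ hconv
  obtain ⟨v, rfl⟩ := exists_incl_eq h hfd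
  exact ⟨v, tendsto_of_tendsto_quad h hf hq⟩

/-- An inclusion of form domains is continuous for the form norms, by the closed graph theorem: both
form norms are complete and dominate the norm of `H`. -/
theorem exists_clm_of_domain_le [CompleteSpace H] (hc : t.IsClosed) {s : SesqForm H} {γ' M' : ℝ}
    (h' : s.IsSectorialWith γ' M') (hsc : s.IsClosed) (hle : t.domain ≤ s.domain) :
    ∃ j : FormSpace h →L[ℂ] FormSpace h', ∀ u, incl h' (j u) = incl h u := by
  have := completeSpace h hc
  have := completeSpace h' hsc
  let j : FormSpace h →ₗ[ℂ] FormSpace h' :=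
    (toDomain h').symm.toLinearMap ∘ₗ Submodule.inclusion hle ∘ₗ (toDomain h).toLinearMap
  have hj : ∀ u, incl h' (j u) = incl h u := fun _ => rfl
  refine ⟨ContinuousLinearMap.ofSeqClosedGraph (g := j) fun _ x y hx hy => ?_, hj⟩
  refine incl_injective h' (tendsto_nhds_unique (((incl h').continuous.tendsto y).comp hy) ?_)
  rw [hj]
  exact ((incl h).continuous.tendsto x).comp hx

/-- The form `s`, transported to the form space of `t`. -/
noncomputable def pullback (s : SesqForm H) (hle : t.domain ≤ s.domain) :
    FormSpace h →ₗ[ℂ] FormSpace h →ₗ⋆[ℂ] ℂ :=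
  LinearMap.mk₂'ₛₗ (RingHom.id ℂ) (starRingEnd ℂ)
    (fun u v => s.form (Submodule.inclusion hle (toDomain h u))
      (Submodule.inclusion hle (toDomain h v)))
    (fun _ _ _ => by simp) (fun _ _ _ => by simp) (fun _ _ _ => by simp) (fun _ _ _ => by simp)

theorem pullback_self (s : SesqForm H) (hle : t.domain ≤ s.domain) (u : FormSpace h) :
    pullback h s hle u u = s.quad (incl h u) :=
  (s.quad_coe (Submodule.inclusion hle (toDomain h u))).symm

/-- A closed sectorial form whose domain contains `t.domain` is represented on the form space of
`t` by a bounded operator. -/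
theorem exists_clm_inner_eq_pullback [CompleteSpace H] (hc : t.IsClosed) {s : SesqForm H}
    (hs : s.IsSectorial) (hsc : s.IsClosed) (hle : t.domain ≤ s.domain) :
    ∃ A : FormSpace h →L[ℂ] FormSpace h, ∀ u v, inner ℂ v (A u) = pullback h s hle u v := by
  have := completeSpace h hc
  obtain ⟨γ', M', h'⟩ := hs.exists_isSectorialWith
  obtain ⟨j, hj⟩ := exists_clm_of_domain_le h hc h' hsc hle
  refine exists_clm_of_sesq (pullback h s hle) (C := (max M' 0 + |γ'|) * ‖j‖ ^ 2) fun u => ?_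
  rw [pullback_self, ← hj]
  refine (norm_quad_le h' _).trans ?_
  rw [mul_assoc, ← mul_pow]
  gcongr
  exact j.le_opNorm u

end FormSpace

end SesqForm

/-! ### The associated operator -/

namespace SesqForm

theorem quad_eq_inner_of_mem_graph {t : SesqForm H} (hd : Dense (t.domain : Set H)) {f w : H}
    (hfw : (f, w) ∈ t.assocOperator.graph) : f ∈ t.domain ∧ t.quad f = inner ℂ f w := by
  obtain ⟨hf, hfw⟩ := (t.mem_graph_assocOperator hd f w).1 hfw
  exact ⟨hf, (t.quad_coe ⟨f, hf⟩).trans (hfw ⟨f, hf⟩)⟩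

namespace FormSpace

variable [CompleteSpace H] {t : SesqForm H} {γ M : ℝ} (h : t.IsSectorialWith γ M)

/-- If `A` represents `t` on its form space and `J` is the inclusion into `H`, then `T f = w` means
`A f = J* w`. -/
theorem mem_graph_assocOperator_iff [CompleteSpace (FormSpace h)]
    (hd : Dense (t.domain : Set H)) {A : FormSpace h →L[ℂ] FormSpace h}
    (hA : ∀ u v, inner ℂ v (A u) = pullback h t le_rfl u v) (u : FormSpace h) (w : H) :
    (incl h u, w) ∈ t.assocOperator.graph ↔ A u = ContinuousLinearMap.adjoint (incl h) w := by
  rw [t.mem_graph_assocOperator hd]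
  constructor
  · rintro ⟨hu, H1⟩
    refine ext_inner_left ℂ fun v => ?_
    rw [hA, ContinuousLinearMap.adjoint_inner_right]
    exact H1 (toDomain h v)
  · intro H1
    refine ⟨incl_mem h u, fun g => ?_⟩
    have H2 := hA u ((toDomain h).symm g)
    rw [H1, ContinuousLinearMap.adjoint_inner_right] at H2
    exact H2.symm

/-- If the numerical range of a closed sectorial form stays away from `0`, then `0` belongs to the
resolvent set of the associated operator: by `|t[f]| ≥ δ‖f‖²` the form is coercive even with respect
to the form norm. -/
theorem isResolventPoint_zero (hd : Dense (t.domain : Set H)) (hc : t.IsClosed)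
    (hs : t.IsSectorial) {δ : ℝ} (hδ : 0 < δ) (hlow : ∀ f ∈ t.domain, δ * ‖f‖ ^ 2 ≤ ‖t.quad f‖) :
    IsResolventPoint t.assocOperator 0 := by
  obtain ⟨γ, M, h⟩ := hs.exists_isSectorialWith
  have := completeSpace h hc
  obtain ⟨A, hA⟩ := exists_clm_inner_eq_pullback h hc hs hc le_rfl
  have hcoer : ∀ u, (1 + |1 - γ| / δ)⁻¹ * ‖u‖ ^ 2 ≤ ‖inner ℂ u (A u)‖ := by
    intro u
    rw [hA, pullback_self, inv_mul_le_iff₀ (by positivity)]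
    have h1 : ‖incl h u‖ ^ 2 ≤ ‖t.quad (incl h u)‖ / δ := by
      rw [le_div_iff₀ hδ, mul_comm]
      exact hlow _ (incl_mem h u)
    calc ‖u‖ ^ 2 ≤ ‖t.quad (incl h u)‖ + |1 - γ| * ‖incl h u‖ ^ 2 := norm_sq_le_quad h u
      _ ≤ ‖t.quad (incl h u)‖ + |1 - γ| * (‖t.quad (incl h u)‖ / δ) := by gcongr
      _ = _ := by ring
  obtain ⟨e, he⟩ := exists_equiv_of_norm_inner_ge A (by positivity) hcoer
  let R : H →L[ℂ] H := incl h ∘L (e.symm : FormSpace h →L[ℂ] FormSpace h) ∘L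
    ContinuousLinearMap.adjoint (incl h)
  have hR : ∀ w, R w = incl h (e.symm (ContinuousLinearMap.adjoint (incl h) w)) := fun w => rfl
  have hgraph : ∀ w, (R w, w) ∈ t.assocOperator.graph := fun w => by
    rw [hR, mem_graph_assocOperator_iff h hd hA, ← he, e.apply_symm_apply]
  refine ⟨R, fun w => ⟨LinearPMap.mem_domain_of_mem_graph (hgraph w), ?_⟩, fun f => ?_⟩
  · rw [zero_smul, sub_zero]
    exact ((LinearPMap.image_iff _).2 (hgraph w)).symm
  · have hf := t.assocOperator.mem_graph f
    obtain ⟨v, hv⟩ := exists_incl_eq h (quad_eq_inner_of_mem_graph hd hf).1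
    rw [← hv, mem_graph_assocOperator_iff h hd hA, ← he] at hf
    rw [zero_smul, sub_zero, hR, ← hf, e.symm_apply_apply, hv]

/-- The domain of the associated operator is dense in the form space. -/
theorem dense_domain_assocOperator (hd : Dense (t.domain : Set H)) (hc : t.IsClosed)
    (hs : t.IsSectorial) : Dense {u : FormSpace h | incl h u ∈ t.assocOperator.domain} := by
  have := completeSpace h hc
  obtain ⟨A, hA⟩ := exists_clm_inner_eq_pullback h hc hs hc le_rfl
  let J := incl h
  -- `B` represents `t + (1 - γ)`, whose real part is the square of the form norm.
  let B : FormSpace h →L[ℂ] FormSpace h :=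
    A + (1 - γ : ℂ) • (ContinuousLinearMap.adjoint J ∘L J)
  have hBapp : ∀ u, B u = A u + (1 - γ : ℂ) • ContinuousLinearMap.adjoint J (J u) := fun u => rfl
  have hB : ∀ u, 1 * ‖u‖ ^ 2 ≤ ‖inner ℂ u (B u)‖ := by
    intro u
    refine le_trans (le_of_eq ?_) (Complex.re_le_norm _)
    have h1 : (1 - γ : ℂ) = ((1 - γ : ℝ) : ℂ) := by push_cast; rfl
    rw [hBapp, inner_add_right, hA, inner_smul_right, ContinuousLinearMap.adjoint_inner_right,
      pullback_self, Complex.add_re, inner_self_eq_norm_sq_to_K, h1, Complex.re_ofReal_mul,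
      one_mul, norm_sq, quad_incl]
    congr 2
    simp [J, incl_apply, ← Complex.ofReal_pow]
  obtain ⟨e, he⟩ := exists_equiv_of_norm_inner_ge B one_pos hB
  have hdense : DenseRange (ContinuousLinearMap.adjoint J) := by
    have h2 := J.orthogonal_ker
    rw [LinearMap.ker_eq_bot.2 (incl_injective h : Function.Injective J),
      Submodule.bot_orthogonal_eq_top] at h2
    intro x
    have h3 : x ∈ (ContinuousLinearMap.adjoint J).range.topologicalClosure := by
      rw [← h2]; trivial
    exact h3
  refine (e.symm.surjective.denseRange.comp hdense e.symm.continuous).mono ?_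
  rintro _ ⟨w, rfl⟩
  set u := e.symm (ContinuousLinearMap.adjoint J w) with hu
  refine LinearPMap.mem_domain_of_mem_graph (y := w - (1 - γ : ℂ) • J u)
    ((mem_graph_assocOperator_iff h hd hA u _).2 ?_)
  have h4 := he u
  rw [hBapp, hu, e.apply_symm_apply, ← hu] at h4
  rw [map_sub, map_smul, eq_sub_iff_add_eq]
  exact h4.symm

end FormSpace

/-- The numerical range of the associated operator is dense in that of the form. -/
theorem exists_mem_domain_assocOperator [CompleteSpace H] {t : SesqForm H}
    (hd : Dense (t.domain : Set H)) (hc : t.IsClosed) (hs : t.IsSectorial) {ε : ℝ} {f : H}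
    (hf : f ∈ t.domain) (hf1 : ‖f‖ = 1) (hfε : ‖t.quad f‖ < ε) :
    ∃ g ∈ t.assocOperator.domain, ‖g‖ = 1 ∧ ‖t.quad g‖ < ε := by
  obtain ⟨γ, M, h⟩ := hs.exists_isSectorialWith
  have := FormSpace.completeSpace h hc
  obtain ⟨A, hA⟩ := FormSpace.exists_clm_inner_eq_pullback h hc hs hc le_rfl
  have hq : ∀ u, t.quad (FormSpace.incl h u) = inner ℂ u (A u) := fun u => by
    rw [hA, FormSpace.pullback_self]
  have hopen : IsOpen {u : FormSpace h |
      ‖t.quad (FormSpace.incl h u)‖ < ε * ‖FormSpace.incl h u‖ ^ 2} := by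
    simp only [hq]
    exact isOpen_lt (by fun_prop) (by fun_prop)
  obtain ⟨u, rfl⟩ := FormSpace.exists_incl_eq h hf
  obtain ⟨v, hv, hvd⟩ := (FormSpace.dense_domain_assocOperator h hd hc hs).inter_open_nonempty _
    hopen ⟨u, by simpa [hf1] using hfε⟩
  rw [Set.mem_ofPred_eq] at hv hvd
  set g := FormSpace.incl h v with hg
  have hg0 : 0 < ‖g‖ := by
    rw [norm_pos_iff]
    rintro h0
    rw [h0, t.quad_zero] at hv
    simp at hv
  refine ⟨(‖g‖ : ℂ)⁻¹ • g, t.assocOperator.domain.smul_mem _ hvd,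
    by simp [norm_smul, hg0.ne'], ?_⟩
  rw [t.quad_smul _ (FormSpace.incl_mem h v), norm_mul]
  simp only [norm_inv, Complex.norm_real, norm_norm, norm_pow]
  rw [inv_pow, inv_mul_lt_iff₀ (by positivity)]
  linarith

end SesqForm

/-! ### Pseudo numerical ranges and approximate zeros of the form -/

/-- A perturbation by `-t(z)[f]` times the inner product, of norm at most `|t(z)[f]|`, makes the unit
vector `f` a zero of the form. -/
theorem formPseudoNumRange_eq (Ω : Set ℂ) (t : ℂ → SesqForm H) :
    formPseudoNumRange Ω t = {z | z ∈ Ω ∧ ∀ ε > 0, ∃ f ∈ (t z).domain, ‖f‖ = 1 ∧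
      ‖(t z).quad f‖ < ε} := by
  have hadd : ∀ z (b : H →L[ℂ] H →L⋆[ℂ] ℂ), ∀ f ∈ (t z).domain,
      ((t z).addBounded b).quad f = (t z).quad f + b f f := by
    intro z b f hf
    rw [(t z).quad_coe ⟨f, hf⟩]
    exact ((t z).addBounded b).quad_coe ⟨f, hf⟩
  ext z
  simp only [formPseudoNumRange, formEpsNumRange, formNumRange, Set.mem_iInter, Set.mem_iUnion,
    Set.mem_ofPred_eq]
  constructor
  · intro hz
    refine ⟨?_, fun ε hε => ?_⟩
    · obtain ⟨_, _, hzΩ, _⟩ := hz 1 one_pos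
      exact hzΩ
    obtain ⟨b, hb, -, f, hf, hf0, hq⟩ := hz ε hε
    change f ∈ (t z).domain at hf
    rw [hadd z b f hf] at hq
    have hf' := norm_pos_iff.2 hf0
    refine ⟨(‖f‖ : ℂ)⁻¹ • f, (t z).domain.smul_mem _ hf, by simp [norm_smul, hf'.ne'], ?_⟩
    rw [(t z).quad_smul _ hf, eq_neg_of_add_eq_zero_left hq, norm_mul, norm_neg]
    simp only [norm_inv, Complex.norm_real, norm_norm, norm_pow]
    rw [inv_pow, inv_mul_lt_iff₀ (by positivity)]
    calc ‖b f f‖ ≤ ‖b‖ * ‖f‖ * ‖f‖ := b.le_opNorm₂ f f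
      _ < ‖f‖ ^ 2 * ε := by
        have : 0 < ‖f‖ ^ 2 := by positivity
        nlinarith
  · rintro ⟨hzΩ, hz⟩ ε hε
    obtain ⟨f, hf, hf1, hq⟩ := hz ε hε
    refine ⟨(-(t z).quad f) • innerSLFlip ℂ, ?_, hzΩ, f, hf, ?_, ?_⟩
    · refine lt_of_le_of_lt ?_ hq
      refine ContinuousLinearMap.opNorm_le_bound₂ _ (norm_nonneg _) fun x y => ?_
      change ‖-(t z).quad f * inner ℂ y x‖ ≤ _
      rw [norm_mul, norm_neg, mul_assoc, mul_comm ‖x‖]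
      gcongr
      exact norm_inner_le_norm _ _
    · rintro rfl; simp at hf1
    · rw [hadd _ _ _ hf]
      simp [hf1]

theorem opPseudoNumRange_eq (Ω : Set ℂ) (T : ℂ → H →ₗ.[ℂ] H) :
    opPseudoNumRange Ω T = {z | z ∈ Ω ∧ ∀ ε > 0, ∃ f : (T z).domain, ‖(f : H)‖ = 1 ∧
      ‖inner ℂ (f : H) (T z f)‖ < ε} := by
  ext z
  simp only [opPseudoNumRange, opEpsNumRange, opNumRange, Set.mem_iInter, Set.mem_iUnion,
    Set.mem_ofPred_eq]
  constructor
  · intro hz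
    refine ⟨?_, fun ε hε => ?_⟩
    · obtain ⟨_, _, hzΩ, _⟩ := hz 1 one_pos
      exact hzΩ
    obtain ⟨B, hB, -, f, hf0, hq⟩ := hz ε hε
    change (T z).domain at f
    change inner ℂ (f : H) (B f + T z f) = 0 at hq
    rw [inner_add_right] at hq
    have hf' := norm_pos_iff.2 hf0
    refine ⟨(‖(f : H)‖ : ℂ)⁻¹ • f, by simp [norm_smul, hf'.ne'], ?_⟩
    rw [LinearPMap.map_smul, Submodule.coe_smul, inner_smul_left, inner_smul_right,
      eq_neg_of_add_eq_zero_right hq]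
    simp only [norm_mul, RCLike.norm_conj, norm_neg, norm_inv, Complex.norm_real, norm_norm]
    rw [inv_mul_lt_iff₀ hf', inv_mul_lt_iff₀ hf']
    calc ‖inner ℂ (f : H) (B f)‖ ≤ ‖(f : H)‖ * ‖B f‖ := norm_inner_le_norm _ _
      _ ≤ ‖(f : H)‖ * (‖B‖ * ‖(f : H)‖) := by gcongr; exact B.le_opNorm _
      _ < ‖(f : H)‖ * (‖(f : H)‖ * ε) := by
        rw [mul_comm ‖B‖]
        gcongr
  · rintro ⟨hzΩ, hz⟩ ε hε
    obtain ⟨f, hf1, hq⟩ := hz ε hε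
    refine ⟨(-inner ℂ (f : H) (T z f)) • ContinuousLinearMap.id ℂ H, ?_, hzΩ, f, ?_, ?_⟩
    · refine lt_of_le_of_lt ?_ hq
      rw [norm_smul, norm_neg]
      exact mul_le_of_le_one_right (norm_nonneg _) ContinuousLinearMap.norm_id_le
    · intro h0; simp [h0] at hf1
    · change inner ℂ (f : H) ((-inner ℂ (f : H) (T z f)) • (f : H) + T z f) = 0
      rw [inner_add_right, inner_smul_right, inner_self_eq_norm_sq_to_K, hf1]
      simp

/-! ### Holomorphic form families -/

section Families

open SesqForm FormSpace

variable {Ω : Set ℂ} {t : ℂ → SesqForm H}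

theorem IsHolomorphicTypeA.differentiableOn_quad (ht : IsHolomorphicTypeA Ω t) {μ : ℂ}
    (hμ : μ ∈ Ω) {f : H} (hf : f ∈ (t μ).domain) :
    DifferentiableOn ℂ (fun z => (t z).quad f) Ω :=
  ht.holomorphic f fun z hz => ht.domain_eq μ hμ z hz ▸ hf

variable [CompleteSpace H]

/-- On compact sets of parameters the forms are uniformly bounded with respect to the form norm of
`t μ`, by the uniform boundedness principle. -/
theorem IsHolomorphicTypeA.exists_norm_quad_le (ht : IsHolomorphicTypeA Ω t) {μ : ℂ} (hμ : μ ∈ Ω)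
    {γ M : ℝ} (h : (t μ).IsSectorialWith γ M) {K : Set ℂ} (hK : K ⊆ Ω) (hKc : IsCompact K) :
    ∃ C, ∀ z ∈ K, ∀ u : FormSpace h, ‖(t z).quad (incl h u)‖ ≤ C * ‖u‖ ^ 2 := by
  have := completeSpace h (ht.closed μ hμ)
  have hle : ∀ z : K, (t μ).domain ≤ (t z).domain := fun z => (ht.domain_eq μ hμ z (hK z.2)).le
  choose A hA using fun z : K => exists_clm_inner_eq_pullback h (ht.closed μ hμ)
    (ht.sectorial z (hK z.2)) (ht.closed z (hK z.2)) (hle z)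
  have hquad : ∀ u : FormSpace h, ∃ C, ∀ z : K, ‖pullback h (t z) (hle z) u u‖ ≤ C := by
    intro u
    obtain ⟨C, hC⟩ := hKc.exists_bound_of_continuousOn
      ((ht.differentiableOn_quad hμ (incl_mem h u)).continuousOn.mono hK)
    exact ⟨C, fun z => by rw [pullback_self]; exact hC z z.2⟩
  have hweak : ∀ u v : FormSpace h, ∃ C, ∀ z : K, ‖innerSL ℂ (A z u) v‖ ≤ C := by
    intro u v
    obtain ⟨C₁, h₁⟩ := hquad (u + v)
    obtain ⟨C₂, h₂⟩ := hquad (u - v)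
    obtain ⟨C₃, h₃⟩ := hquad (u + Complex.I • v)
    obtain ⟨C₄, h₄⟩ := hquad (u - Complex.I • v)
    refine ⟨(C₁ + C₂ + C₃ + C₄) / 4, fun z => ?_⟩
    rw [innerSL_apply_apply, norm_inner_symm, hA, le_div_iff₀ (by norm_num)]
    linarith [norm_sesq_le (pullback h (t z) (hle z)) u v, h₁ z, h₂ z, h₃ z, h₄ z]
  have hstrong : ∀ u : FormSpace h, ∃ C, ∀ z : K, ‖A z u‖ ≤ C := by
    intro u
    obtain ⟨C, hC⟩ := banach_steinhaus (hweak u)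
    exact ⟨C, fun z => by simpa only [innerSL_apply_norm] using hC z⟩
  obtain ⟨C, hC⟩ := banach_steinhaus hstrong
  refine ⟨C, fun z hz u => ?_⟩
  rw [← pullback_self h (t z) (hle ⟨z, hz⟩), ← hA ⟨z, hz⟩]
  calc _ ≤ ‖u‖ * ‖A ⟨z, hz⟩ u‖ := norm_inner_le_norm _ _
    _ ≤ ‖u‖ * (C * ‖u‖) := by
      gcongr
      exact (A ⟨z, hz⟩).le_of_opNorm_le (hC _) u
    _ = _ := by ring

/-- The uniform bound on compact sets of parameters, with the form norm of `t μ` written out. -/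
theorem IsHolomorphicTypeA.exists_norm_quad_le_quad (ht : IsHolomorphicTypeA Ω t) {μ : ℂ}
    (hμ : μ ∈ Ω) {K : Set ℂ} (hK : K ⊆ Ω) (hKc : IsCompact K) :
    ∃ C, 0 ≤ C ∧ ∀ z ∈ K, ∀ f ∈ (t μ).domain,
      ‖(t z).quad f‖ ≤ C * (‖(t μ).quad f‖ + ‖f‖ ^ 2) := by
  obtain ⟨γ, M, h⟩ := (ht.sectorial μ hμ).exists_isSectorialWith
  obtain ⟨C, hC⟩ := ht.exists_norm_quad_le hμ h hK hKc
  refine ⟨max C 0 * (1 + |1 - γ|), by positivity, fun z hz f hf => ?_⟩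
  obtain ⟨u, rfl⟩ := exists_incl_eq h hf
  calc _ ≤ C * ‖u‖ ^ 2 := hC z hz u
    _ ≤ max C 0 * (‖(t μ).quad (incl h u)‖ + |1 - γ| * ‖incl h u‖ ^ 2) := by
      gcongr
      · exact le_max_left _ _
      · exact norm_sq_le_quad h u
    _ ≤ _ := by
      rw [mul_assoc]
      gcongr
      nlinarith [mul_nonneg (abs_nonneg (1 - γ)) (norm_nonneg ((t μ).quad (incl h u))),
        sq_nonneg ‖incl h u‖]

/-- The lower bound for `t⁽ᵏ⁾(μ)` extends from a core to the whole domain. -/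
theorem IsHolomorphicTypeA.norm_derivQuad_ge (hΩ : IsOpen Ω) (ht : IsHolomorphicTypeA Ω t)
    {k : ℕ} {μ : ℂ} (hμ : μ ∈ Ω) {D : Submodule ℂ H} (hD : (t μ).IsCore D) {δ : ℝ}
    (hδ : ∀ f ∈ D, δ * ‖f‖ ^ 2 ≤ ‖derivQuad t k μ f‖) {f : H} (hf : f ∈ (t μ).domain) :
    δ * ‖f‖ ^ 2 ≤ ‖derivQuad t k μ f‖ := by
  obtain ⟨γ, M, h⟩ := (ht.sectorial μ hμ).exists_isSectorialWith
  have := completeSpace h (ht.closed μ hμ)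
  obtain ⟨w, hwD, hw⟩ := hD.2 f hf
  obtain ⟨-, hq⟩ := ht.closed μ hμ w f hw
  obtain ⟨v, rfl⟩ := exists_incl_eq h hf
  choose u hu using fun n => exists_incl_eq h (hw.1 n)
  obtain rfl : (fun n => incl h (u n)) = w := funext hu
  have huv : Tendsto u atTop (𝓝 v) := tendsto_of_tendsto_quad h hw.2.1 hq
  have hdiff : ∀ n, DifferentiableOn ℂ (fun z => (t z).quad (incl h (u n))) Ω := fun n =>
    ht.differentiableOn_quad hμ (incl_mem h _)
  have hpt : ∀ z ∈ Ω, Tendsto (fun n => (t z).quad (incl h (u n))) atTop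
      (𝓝 ((t z).quad (incl h v))) := by
    intro z hz
    obtain ⟨A, hA⟩ := exists_clm_inner_eq_pullback h (ht.closed μ hμ) (ht.sectorial z hz)
      (ht.closed z hz) (ht.domain_eq μ hμ z hz).le
    simp only [← pullback_self h (t z) (ht.domain_eq μ hμ z hz).le, ← hA]
    exact huv.inner ((A.continuous.tendsto v).comp huv)
  have hloc := tendstoLocallyUniformlyOn_of_pointwise (l := atTop) hΩ hdiff (fun K hK hKc => by
    obtain ⟨C, hC⟩ := ht.exists_norm_quad_le hμ h hK hKc
    obtain ⟨R, hR⟩ := huv.norm.bddAbove_range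
    refine ⟨max C 0 * R ^ 2, fun n z hz => (hC z hz _).trans ?_⟩
    gcongr
    · exact le_max_left _ _
    · exact hR ⟨n, rfl⟩) hpt
  have hderiv := (hloc.iteratedDeriv hΩ hdiff k).tendsto_at hμ
  exact le_of_tendsto_of_tendsto' ((hw.2.1.norm.pow 2).const_mul δ) hderiv.norm
    fun n => hδ _ (hwD n)

/-- If `t(z₀)[f]` is arbitrarily small for unit vectors `f ∈ S`, then `z₀` is a limit of zeros of the
functions `z ↦ t(z)[f]`, `f ∈ S`. Otherwise a limit of such functions would vanish identically, by
Hurwitz's theorem, although its `k`-th derivative at `μ` is nonzero. -/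
theorem IsHolomorphicTypeA.mem_closure_zeros (hΩ : IsOpen Ω) (hΩc : IsPreconnected Ω)
    (ht : IsHolomorphicTypeA Ω t) {k : ℕ} {μ : ℂ} (hμ : μ ∈ Ω) {δ : ℝ} (hδ0 : 0 < δ)
    (hδ : ∀ f ∈ (t μ).domain, δ * ‖f‖ ^ 2 ≤ ‖derivQuad t k μ f‖)
    {S : Set H} {z₀ : ℂ} (hz₀ : z₀ ∈ Ω) (hS : S ⊆ (t z₀).domain)
    (happrox : ∀ ε > 0, ∃ f ∈ S, ‖f‖ = 1 ∧ ‖(t z₀).quad f‖ < ε) :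
    z₀ ∈ closure {z | z ∈ Ω ∧ ∃ f ∈ S, f ≠ 0 ∧ (t z).quad f = 0} := by
  by_contra hcl
  obtain ⟨r, hr, hball⟩ := Metric.isOpen_iff.1 isClosed_closure.isOpen_compl z₀ hcl
  choose f hfS hf1 hfq using fun n : ℕ => happrox (1 / ((n : ℝ) + 1)) (by positivity)
  have hdiff : ∀ n, DifferentiableOn ℂ (fun z => (t z).quad (f n)) Ω := fun n =>
    ht.differentiableOn_quad hz₀ (hS (hfS n))
  let 𝒰 : Ultrafilter ℕ := hyperfilter ℕ
  obtain ⟨h, hh⟩ := exists_tendstoLocallyUniformlyOn_ultrafilter 𝒰 hΩ hdiff (fun K hK hKc => by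
    obtain ⟨C, hC0, hC⟩ := ht.exists_norm_quad_le_quad hz₀ hK hKc
    refine ⟨C * (1 + 1), fun n z hz => (hC z hz _ (hS (hfS n))).trans ?_⟩
    gcongr
    · refine (hfq n).le.trans ?_
      rw [div_le_one (by positivity)]
      linarith [(Nat.cast_nonneg n : (0 : ℝ) ≤ n)]
    · simp [hf1])
  have hh0 : h z₀ = 0 := by
    have h1 : Tendsto (fun n => (t z₀).quad (f n)) atTop (𝓝 0) :=
      squeeze_zero_norm (fun n => (hfq n).le) tendsto_one_div_add_atTop_nhds_zero_nat
    exact tendsto_nhds_unique (hh.tendsto_at hz₀) (h1.mono_left Nat.hyperfilter_le_atTop)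
  have hzero : Set.EqOn h 0 Ω := eqOn_zero_of_tendstoLocallyUniformlyOn hΩ hΩc hdiff hh hz₀ hh0 hr
    fun n z hz hq => hball hz.1 (subset_closure
      ⟨hz.2, f n, hfS n, norm_pos_iff.1 (by rw [hf1]; exact one_pos), hq⟩)
  have hderiv0 : iteratedDeriv k h μ = 0 := by
    have h2 : h =ᶠ[𝓝 μ] fun _ => 0 := hzero.eventuallyEq_of_mem (hΩ.mem_nhds hμ)
    rw [h2.iteratedDeriv_eq]
    simp
  have hlim := ((hh.iteratedDeriv hΩ hdiff k).tendsto_at hμ).norm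
  rw [hderiv0, norm_zero] at hlim
  refine absurd (ge_of_tendsto' hlim fun n => ?_) (not_le.2 hδ0)
  have h3 := hδ (f n) (ht.domain_eq z₀ hz₀ μ hμ ▸ hS (hfS n))
  rwa [hf1, one_pow, mul_one] at h3

/-- Zeros of the forms near `z₀` make `t(z₀)[f]` small, because the forms depend on the parameter in
a locally relatively bounded Lipschitz way. -/
theorem IsHolomorphicTypeA.exists_norm_quad_lt (hΩ : IsOpen Ω) (ht : IsHolomorphicTypeA Ω t)
    {z₀ : ℂ} (hz₀ : z₀ ∈ Ω) (hcl : z₀ ∈ closure (formNumRange Ω t)) {ε : ℝ} (hε : 0 < ε) :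
    ∃ f ∈ (t z₀).domain, ‖f‖ = 1 ∧ ‖(t z₀).quad f‖ < ε := by
  obtain ⟨R, hR, hRΩ⟩ := Metric.isOpen_iff.1 hΩ z₀ hz₀
  set r := R / 3 with hr
  have hr0 : 0 < r := by positivity
  have hK : Metric.closedBall z₀ (2 * r) ⊆ Ω :=
    (Metric.closedBall_subset_ball (by linarith)).trans hRΩ
  obtain ⟨C, hC0, hC⟩ := ht.exists_norm_quad_le_quad hz₀ hK (isCompact_closedBall _ _)
  -- `θ` is the bound wanted for the relative Lipschitz constant `C / r` times the distance to `z₀`.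
  set θ := min (1 / 2) (ε / 4) with hθ
  have hθ0 : 0 < θ := by positivity
  obtain ⟨z, ⟨hzΩ, f, hf, hf0, hq⟩, hz⟩ :=
    Metric.mem_closure_iff.1 hcl (min r (θ * r / (C + 1))) (by positivity)
  have hf' := norm_pos_iff.2 hf0
  rw [ht.domain_eq z hzΩ z₀ hz₀] at hf
  set g := (‖f‖ : ℂ)⁻¹ • f with hg
  have hgd : g ∈ (t z₀).domain := (t z₀).domain.smul_mem _ hf
  have hg1 : ‖g‖ = 1 := by simp [hg, norm_smul, hf'.ne']
  have hgq : (t z).quad g = 0 := by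
    rw [hg, (t z).quad_smul _ (ht.domain_eq z₀ hz₀ z hzΩ ▸ hf), hq, mul_zero]
  refine ⟨g, hgd, hg1, ?_⟩
  rw [dist_comm, dist_eq_norm] at hz
  have hzr : z ∈ Metric.ball z₀ r := by
    rw [Metric.mem_ball, dist_eq_norm]; exact hz.trans_le (min_le_left _ _)
  have hLip := norm_sub_le_of_norm_le_closedBall hΩ (ht.differentiableOn_quad hz₀ hgd) hr0 hK
    (fun w hw => hC w hw g hgd) hzr
  rw [hgq, zero_sub, norm_neg, hg1, one_pow] at hLip
  set q := ‖(t z₀).quad g‖ with hq'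
  have hq0 : 0 ≤ q := norm_nonneg _
  have hd : C / r * ‖z - z₀‖ ≤ θ := by
    calc C / r * ‖z - z₀‖ ≤ (C + 1) / r * (θ * r / (C + 1)) := by
          gcongr
          · linarith
          · exact hz.le.trans (min_le_right _ _)
      _ = θ := by field_simp
  have h1 : q ≤ θ * (q + 1) := by
    calc q ≤ C * (q + 1) / r * ‖z - z₀‖ := hLip
      _ = C / r * ‖z - z₀‖ * (q + 1) := by ring
      _ ≤ θ * (q + 1) := by gcongr
  have h2 : θ ≤ 1 / 2 := min_le_left _ _
  have h3 : θ ≤ ε / 4 := min_le_right _ _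
  nlinarith

end Families

/-! ### Spectral inclusion and the closure of the numerical range -/

section Conclusion

open SesqForm

theorem mul_norm_sq_le_of_unit {q : H → ℂ} {D : Submodule ℂ H} {δ : ℝ}
    (hq : ∀ (c : ℂ), ∀ f ∈ D, q (c • f) = (‖c‖ : ℂ) ^ 2 * q f)
    (hδ : ∀ f ∈ D, ‖f‖ = 1 → δ ≤ ‖q f‖) : ∀ f ∈ D, δ * ‖f‖ ^ 2 ≤ ‖q f‖ := by
  intro f hf
  rcases eq_or_ne f 0 with rfl | hf0
  · simp
  have hf' := norm_pos_iff.2 hf0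
  have h := hδ ((‖f‖ : ℂ)⁻¹ • f) (D.smul_mem _ hf) (by simp [norm_smul, hf'.ne'])
  rw [hq _ f hf, norm_mul] at h
  simp only [norm_inv, Complex.norm_real, norm_norm, norm_pow] at h
  rw [inv_pow, le_inv_mul_iff₀ (by positivity)] at h
  linarith

variable {Ω : Set ℂ} {t : ℂ → SesqForm H}

theorem IsHolomorphicTypeA.derivQuad_smul (hΩ : IsOpen Ω) (ht : IsHolomorphicTypeA Ω t) (k : ℕ)
    {μ : ℂ} (hμ : μ ∈ Ω) (c : ℂ) {f : H} (hf : f ∈ (t μ).domain) :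
    derivQuad t k μ (c • f) = (‖c‖ : ℂ) ^ 2 * derivQuad t k μ f := by
  have h : (fun z => (t z).quad (c • f)) =ᶠ[𝓝 μ] fun z => (‖c‖ : ℂ) ^ 2 * (t z).quad f := by
    filter_upwards [hΩ.mem_nhds hμ] with z hz
    exact (t z).quad_smul c (ht.domain_eq μ hμ z hz ▸ hf)
  rw [derivQuad, h.iteratedDeriv_eq, iteratedDeriv_const_mul_field]
  rfl

theorem IsHolomorphicTypeA.exists_mul_norm_sq_le_derivQuad [CompleteSpace H] (hΩ : IsOpen Ω)
    (ht : IsHolomorphicTypeA Ω t) {k : ℕ} {μ : ℂ} (hμ : μ ∈ Ω) {D : Submodule ℂ H}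
    (hD : (t μ).IsCore D) (h0 : (0 : ℂ) ∉ closure (numRangeOn (derivQuad t k μ) D)) :
    ∃ δ > 0, ∀ f ∈ (t μ).domain, δ * ‖f‖ ^ 2 ≤ ‖derivQuad t k μ f‖ := by
  obtain ⟨δ, hδ, hball⟩ := Metric.isOpen_iff.1 isClosed_closure.isOpen_compl 0 h0
  refine ⟨δ, hδ, fun f hf => ht.norm_derivQuad_ge hΩ hμ hD ?_ hf⟩
  refine mul_norm_sq_le_of_unit (fun c f hf => ht.derivQuad_smul hΩ k hμ c (hD.1 hf))
    fun f hf hf1 => ?_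
  by_contra hlt
  exact hball (by simpa using hlt) (subset_closure ⟨f, hf, hf1, rfl⟩)

theorem IsHolomorphicTypeA.famSpectrum_subset [CompleteSpace H] (ht : IsHolomorphicTypeA Ω t)
    {T : ℂ → H →ₗ.[ℂ] H} (hT : IsAssociatedFamily Ω T t) :
    famSpectrum Ω T ⊆ formPseudoNumRange Ω t := by
  rintro z ⟨hz, hspec⟩
  rw [formPseudoNumRange_eq]
  refine ⟨hz, fun ε hε => ?_⟩
  by_contra! hfar
  refine hspec ?_
  rw [hT z hz]
  exact FormSpace.isResolventPoint_zero (ht.dense z hz) (ht.closed z hz) (ht.sectorial z hz) hε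
    (mul_norm_sq_le_of_unit (fun c f hf => (t z).quad_smul c hf) hfar)

theorem IsHolomorphicTypeA.mem_domain_and_quad_eq (ht : IsHolomorphicTypeA Ω t)
    {T : ℂ → H →ₗ.[ℂ] H} (hT : IsAssociatedFamily Ω T t) {z : ℂ} (hz : z ∈ Ω) (f : (T z).domain) :
    (f : H) ∈ (t z).domain ∧ (t z).quad f = inner ℂ (f : H) (T z f) :=
  quad_eq_inner_of_mem_graph (ht.dense z hz) (by rw [← hT z hz]; exact (T z).mem_graph f)

/-- Form and associated operator family have the same pseudo numerical range, since the numerical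
range of `T z` is dense in that of `t z`. -/
theorem IsHolomorphicTypeA.opPseudoNumRange_eq_formPseudoNumRange [CompleteSpace H]
    (ht : IsHolomorphicTypeA Ω t) {T : ℂ → H →ₗ.[ℂ] H} (hT : IsAssociatedFamily Ω T t) :
    opPseudoNumRange Ω T = formPseudoNumRange Ω t := by
  rw [opPseudoNumRange_eq, formPseudoNumRange_eq]
  ext z
  refine and_congr_right fun hz => forall₂_congr fun ε _ => ?_
  constructor
  · rintro ⟨f, hf1, hq⟩
    obtain ⟨hfd, hfq⟩ := ht.mem_domain_and_quad_eq hT hz f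
    exact ⟨f, hfd, hf1, hfq ▸ hq⟩
  · rintro ⟨f, hf, hf1, hq⟩
    obtain ⟨g, hg, hg1, hgq⟩ := exists_mem_domain_assocOperator (ht.dense z hz) (ht.closed z hz)
      (ht.sectorial z hz) hf hf1 hq
    rw [← hT z hz] at hg
    refine ⟨⟨g, hg⟩, hg1, ?_⟩
    rwa [← (ht.mem_domain_and_quad_eq hT hz ⟨g, hg⟩).2]

theorem IsHolomorphicTypeA.closure_formNumRange_inter_subset [CompleteSpace H] (hΩ : IsOpen Ω)
    (ht : IsHolomorphicTypeA Ω t) : closure (formNumRange Ω t) ∩ Ω ⊆ formPseudoNumRange Ω t := by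
  rintro z ⟨hcl, hz⟩
  rw [formPseudoNumRange_eq]
  exact ⟨hz, fun ε hε => ht.exists_norm_quad_lt hΩ hz hcl hε⟩

theorem IsHolomorphicTypeA.mem_opNumRange_iff (ht : IsHolomorphicTypeA Ω t)
    {T : ℂ → H →ₗ.[ℂ] H} (hT : IsAssociatedFamily Ω T t) {z : ℂ} (hz : z ∈ Ω) :
    z ∈ opNumRange Ω T ↔ ∃ f ∈ (T z).domain, f ≠ 0 ∧ (t z).quad f = 0 := by
  constructor
  · rintro ⟨-, f, hf0, h0⟩
    exact ⟨f, f.2, hf0, (ht.mem_domain_and_quad_eq hT hz f).2.trans h0⟩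
  · rintro ⟨f, hf, hf0, h0⟩
    exact ⟨hz, ⟨f, hf⟩, hf0, (ht.mem_domain_and_quad_eq hT hz ⟨f, hf⟩).2.symm.trans h0⟩

theorem IsHolomorphicTypeA.opNumRange_subset (ht : IsHolomorphicTypeA Ω t)
    {T : ℂ → H →ₗ.[ℂ] H} (hT : IsAssociatedFamily Ω T t) : opNumRange Ω T ⊆ formNumRange Ω t := by
  intro z hzT
  have hz : z ∈ Ω := hzT.1
  obtain ⟨f, hf, hf0, h0⟩ := (ht.mem_opNumRange_iff hT hz).1 hzT
  exact ⟨hz, f, (ht.mem_domain_and_quad_eq hT hz ⟨f, hf⟩).1, hf0, h0⟩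

end Conclusion

end PseudoNumRange

theorem theorem3p3 {H : Type*} [NormedAddCommGroup H] [InnerProductSpace ℂ H] [CompleteSpace H]
    (Ω : Set ℂ) (hΩ_open : IsOpen Ω) (hΩ_conn : IsConnected Ω)
    (t : ℂ → PseudoNumRange.SesqForm H) (ht : PseudoNumRange.IsHolomorphicTypeA Ω t)
    (T : ℂ → H →ₗ.[ℂ] H) (hT : PseudoNumRange.IsAssociatedFamily Ω T t)
    (hcore : ∃ (k : ℕ) (μ : ℂ) (D : Submodule ℂ H), μ ∈ Ω ∧ (t μ).IsCore D ∧
      (0 : ℂ) ∉ closure (PseudoNumRange.numRangeOn (PseudoNumRange.derivQuad t k μ) D)) :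
    (PseudoNumRange.famSpectrum Ω T ⊆ PseudoNumRange.formPseudoNumRange Ω t ∧
      PseudoNumRange.formPseudoNumRange Ω t =
        closure (PseudoNumRange.formNumRange Ω t) ∩ Ω) ∧
    (PseudoNumRange.HasConstantDomain Ω T →
      PseudoNumRange.famSpectrum Ω T ⊆ PseudoNumRange.opPseudoNumRange Ω T ∧
      PseudoNumRange.opPseudoNumRange Ω T =
        closure (PseudoNumRange.opNumRange Ω T) ∩ Ω) := by
  obtain ⟨k, μ, D, hμ, hD, h0⟩ := hcore
  obtain ⟨δ, hδ0, hδ⟩ := ht.exists_mul_norm_sq_le_derivQuad hΩ_open hμ hD h0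
  have hσ := ht.famSpectrum_subset hT
  have hcl := ht.closure_formNumRange_inter_subset hΩ_open
  refine ⟨⟨hσ, Set.Subset.antisymm (fun z hz => ?_) hcl⟩, fun hdom => ?_⟩
  · rw [PseudoNumRange.formPseudoNumRange_eq] at hz
    obtain ⟨hzΩ, happ⟩ := hz
    refine ⟨closure_mono ?_ (ht.mem_closure_zeros hΩ_open hΩ_conn.isPreconnected hμ hδ0 hδ
      hzΩ subset_rfl happ), hzΩ⟩
    rintro w ⟨hw, f, hf, hf0, hq⟩
    rw [SetLike.mem_coe, ht.domain_eq z hzΩ w hw] at hf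
    exact ⟨hw, f, hf, hf0, hq⟩
  · have heq := ht.opPseudoNumRange_eq_formPseudoNumRange hT
    refine ⟨heq ▸ hσ, Set.Subset.antisymm (fun z hz => ?_) fun z hz => ?_⟩
    · rw [PseudoNumRange.opPseudoNumRange_eq] at hz
      obtain ⟨hzΩ, happ⟩ := hz
      refine ⟨closure_mono ?_ (ht.mem_closure_zeros hΩ_open hΩ_conn.isPreconnected hμ hδ0 hδ
        (S := (T z).domain) hzΩ (fun f hf => (ht.mem_domain_and_quad_eq hT hzΩ ⟨f, hf⟩).1)
        fun ε hε => ?_), hzΩ⟩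
      · -- The zeros found at `w` come from vectors of `dom T z`, which is also `dom T w`.
        rintro w ⟨hw, f, hf, hf0, hq0⟩
        rw [SetLike.mem_coe, hdom z hzΩ w hw] at hf
        exact (ht.mem_opNumRange_iff hT hw).2 ⟨f, hf, hf0, hq0⟩
      · obtain ⟨f, hf1, hfε⟩ := happ ε hε
        exact ⟨f, f.2, hf1, (ht.mem_domain_and_quad_eq hT hzΩ f).2 ▸ hfε⟩
    · rw [heq]
      exact hcl ⟨closure_mono (ht.opNumRange_subset hT) hz.1, hz.2⟩
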